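/- Let $P$ be a finite nonempty poset, let $|P|$ be its number of elements and $h(P)$ the number of elements of a longest chain in $P$. For a prime power $q$ and an $n$-dimensional vector space $V$ over the field $\mathbb{F}_q$ with $q$ elements, let $\mathrm{La}_q(n,P)$ be the maximum size of a family $\mathcal{F}$ of subspaces of $V$ that, ordered by inclusion, does not contain $P$ as a subposet; here $P$ is a subposet of $Q$ if there is an injection $\phi:P\to Q$ such that $x\le_P y$ implies $\phi(x)\le_Q\phi(y)$. For integers $0\le m\le n$ let \[ {n \brack m}_q=\prod_{0\le i<m}\frac{q^{n-i}-1}{q^{m-i}-1}. \] Then for every fixed integer $k\ge 2$ there is an $n_0=n_0(P,k)$ such that for all $n\ge n_0$ and all prime powers $q$, \[ \mathrm{La}_q(n,P)\le \frac{1}{2^{k-1}}\Big(|P|+(3k-5)2^{k-2}\big(h(P)-1\big)-1\Big){n \brack \lfloor n/2\rfloor}_q . \] -/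

import Mathlib

/-- `P` is a (weak, not necessarily induced) subposet of `Q`: some injection `φ : P → Q` satisfies
`x ≤ y → φ x ≤ φ y`. -/
def IsSubposet (P Q : Type*) [PartialOrder P] [PartialOrder Q] : Prop :=
  ∃ φ : P → Q, Function.Injective φ ∧ ∀ x y : P, x ≤ y → φ x ≤ φ y

/-- The height `h(P)`: the largest number of elements of a chain in `P`. -/
noncomputable def posetHeight (P : Type*) [PartialOrder P] : ℕ :=
  ((Set.univ : Set P).chainHeight (· ≤ ·)).toNat

/-- For `V` of dimension `n` over the field with `q` elements, `linearLa K V P` is `La_q(n, P)`: the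
maximum size of a family of subspaces of `V` which, ordered by inclusion, does not contain `P` as a
subposet. -/
noncomputable def linearLa (K V P : Type*) [Field K] [AddCommGroup V] [Module K V]
    [PartialOrder P] : ℕ :=
  sSup {m : ℕ | ∃ 𝓕 : Set (Submodule K V), ¬ IsSubposet P 𝓕 ∧ 𝓕.ncard = m}

/-- The Gaussian binomial coefficient, for `q > 1` and `k ≤ n`:
`∏_{0 ≤ i < k} (q^(n-i) - 1) / (q^(k-i) - 1)`. -/
noncomputable def gaussBinom (q n k : ℕ) : ℝ :=
  ∏ i ∈ Finset.range k, ((q : ℝ) ^ (n - i) - 1) / ((q : ℝ) ^ (k - i) - 1)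

/-- The maximum in the definition of `linearLa` is attained when `V` is finite and `P` nonempty. -/
theorem isGreatest_linearLa (K V P : Type*) [Field K] [AddCommGroup V] [Module K V] [Finite V]
    [PartialOrder P] [Nonempty P] :
    IsGreatest {m : ℕ | ∃ 𝓕 : Set (Submodule K V), ¬ IsSubposet P 𝓕 ∧ 𝓕.ncard = m}
      (linearLa K V P) := by
  have hfin : Finite (Submodule K V) := inferInstance
  have hb : BddAbove {m : ℕ | ∃ 𝓕 : Set (Submodule K V), ¬ IsSubposet P 𝓕 ∧ 𝓕.ncard = m} := by
    refine ⟨Nat.card (Submodule K V), ?_⟩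
    rintro m ⟨𝓕, -, rfl⟩
    exact Set.ncard_le_card 𝓕
  refine ⟨Nat.sSup_mem ⟨0, ∅, ?_, Set.ncard_empty _⟩ hb, fun m hm => le_csSup hb hm⟩
  rintro ⟨φ, -, -⟩
  exact (φ (Classical.arbitrary P)).2

/-! Write `k = l + 2`. The interval chain consists of the sets `[0, i) ∪ (U + i + 1)` with `U ⊆ {0,
…, l}`. Away from the ends of `range n` it has at least `2 ^ (l + 1)` sets of each size, yet it is
nearly a chain: ordered by `intervalChainKey`, all but `(3l + 1) 2 ^ l` of the later sets contain
every set up to a given one. Embedding `P` greedily level by level loses at most that many sets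
between consecutive levels, hence `h(P) - 1` times (`exists_embedding_intervalChain`).

Sets of basis indices become spans. In each image of the interval chain under `GL(V)`, a `P`-free
family meets fewer than `|P| + (h(P) - 1)(3l + 1) 2 ^ l` members. Averaging over `GL(V)`, which is
transitive on subspaces of each dimension, gives the weighted inequality
`sum_card_div_gaussBinom_le`. Every subspace has weight at least `2 ^ (l + 1)` over the central
Gaussian binomial: in middle dimensions by the number of sets, near the ends because Gaussian
binomials at least double at each step towards the middle. -/

open Finset

/-! ### Greedy embedding of posets -/

/-- Any sufficiently large finite set has an initial segment, with respect to a key, of each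
smaller size. -/
theorem exists_initial_segment {α : Type*} [DecidableEq α] (key : α → ℕ) (J : Finset α) (p : ℕ)
    (hp : p ≤ #J) :
    ∃ A ⊆ J, #A = p ∧ ∀ a ∈ A, ∀ b ∈ J \ A, key a ≤ key b := by
  induction p with
  | zero => exact ⟨∅, by simp, by simp, by simp⟩
  | succ p ih =>
    obtain ⟨A, hAJ, hA, hmin⟩ := ih (by omega)
    have hne : (J \ A).Nonempty := by
      rw [← card_pos, card_sdiff_of_subset hAJ]; omega
    obtain ⟨x, hx, hxmin⟩ := exists_min_image (J \ A) key hne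
    have hx' := mem_sdiff.1 hx
    refine ⟨insert x A, insert_subset hx'.1 hAJ, by rw [card_insert_of_notMem hx'.2, hA], ?_⟩
    intro a ha b hb
    have hb' : b ∈ J \ A := by
      simp only [mem_sdiff, mem_insert, not_or] at hb ⊢
      exact ⟨hb.1, hb.2.2⟩
    rcases mem_insert.1 ha with rfl | ha
    · exact hxmin b hb'
    · exact hmin a ha b hb'

theorem exists_injOn_mapsTo_of_card_le {P α : Type*} [Nonempty α] {Q : Finset P} {A : Finset α}
    (h : #Q ≤ #A) : ∃ φ : P → α, (∀ x ∈ Q, φ x ∈ A) ∧ Set.InjOn φ Q := by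
  obtain ⟨φ, hφ, hinj⟩ := Q.finite_toSet.exists_injOn_of_encard_le (t := (A : Set α))
    (by simpa using h)
  exact ⟨φ, fun x hx => hφ hx, hinj⟩

/-- Greedy embedding of a poset, level by level, into a finite set `J` of elements of `C`. The bound
`B` controls how many elements of `C` are lost because they are not above an initial segment. -/
theorem exists_embedding_of_key {P α : Type*} [PartialOrder P] [Nonempty α] (R : α → α → Prop)
    (hR : ∀ a, R a a) (key : α → ℕ) (C : Finset α) (B : ℕ)
    (hB : ∀ X ∈ C, ∀ T ⊆ C, (∀ Y ∈ T, Y ≠ X ∧ key X ≤ key Y ∧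
      ∃ Z ∈ C, key Z ≤ key X ∧ ¬ R Z Y) → #T ≤ B)
    (h : ℕ) (J : Finset α) (Q : Finset P) (lev : P → ℕ) (hJC : J ⊆ C)
    (hlev : ∀ x ∈ Q, ∀ y ∈ Q, x < y → lev x < lev y) (hle : ∀ x ∈ Q, lev x ≤ h)
    (hcard : #Q + h * B ≤ #J) :
    ∃ φ : P → α, Set.InjOn φ Q ∧ (∀ x ∈ Q, φ x ∈ J) ∧
      ∀ x ∈ Q, ∀ y ∈ Q, x ≤ y → R (φ x) (φ y) := by
  classical
  induction h generalizing J Q lev with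
  | zero =>
    obtain ⟨φ, hφ, hinj⟩ := exists_injOn_mapsTo_of_card_le (Q := Q) (A := J) (by omega)
    refine ⟨φ, hinj, hφ, fun x hx y hy hxy => ?_⟩
    rcases hxy.eq_or_lt with rfl | hlt
    · exact hR _
    · have := hlev x hx y hy hlt
      have := hle y hy
      omega
  | succ h ih =>
    have hsplit : #(Q.filter (lev · = 0)) + #(Q.filter (lev · ≠ 0)) = #Q :=
      card_filter_add_card_filter_not _
    rw [add_one_mul] at hcard
    obtain ⟨A, hAJ, hA, hmin⟩ :=
      exists_initial_segment key J #(Q.filter (lev · = 0)) (by omega)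
    have hJA : #(J \ A) + #A = #J := card_sdiff_add_card_eq_card hAJ
    have hsplit' : #((J \ A).filter fun Y => ∀ a ∈ A, R a Y) +
        #((J \ A).filter fun Y => ¬ ∀ a ∈ A, R a Y) = #(J \ A) :=
      card_filter_add_card_filter_not _
    -- The key-last element of `A` serves as the `X` of `hB`: all of `A` comes no later, all of `J \
    -- A` no earlier.
    have hT : #((J \ A).filter fun Y => ¬ ∀ a ∈ A, R a Y) ≤ B := by
      rcases A.eq_empty_or_nonempty with hA0 | hA0
      · simp [hA0]
      · obtain ⟨X, hX, hXmax⟩ := exists_max_image A key hA0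
        refine hB X (hJC (hAJ hX)) _ (fun Y hY => ?_) fun Y hY => ?_
        · exact hJC (mem_sdiff.1 (mem_filter.1 hY).1).1
        · obtain ⟨hY, hYR⟩ := mem_filter.1 hY
          push Not at hYR
          obtain ⟨Z, hZ, hZR⟩ := hYR
          refine ⟨?_, hmin X hX Y hY, Z, hJC (hAJ hZ), hXmax Z hZ, hZR⟩
          rintro rfl
          exact (mem_sdiff.1 hY).2 hX
    obtain ⟨φ, hinj, hφ, hφR⟩ := ih ((J \ A).filter fun Y => ∀ a ∈ A, R a Y)
      (Q.filter (lev · ≠ 0)) (lev · - 1)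
      (fun Y hY => hJC (mem_sdiff.1 (mem_filter.1 hY).1).1)
      (fun x hx y hy hxy => by
        have := hlev x (mem_filter.1 hx).1 y (mem_filter.1 hy).1 hxy
        have := (mem_filter.1 hx).2
        omega)
      (fun x hx => by
        have := hle x (mem_filter.1 hx).1
        omega)
      (by omega)
    obtain ⟨ψ, hψ, hψinj⟩ := exists_injOn_mapsTo_of_card_le hA.ge
    have hψ' : ∀ x ∈ Q, lev x = 0 → ψ x ∈ A := fun x hx h0 => hψ x (mem_filter.2 ⟨hx, h0⟩)
    have hφ' : ∀ x ∈ Q, lev x ≠ 0 → φ x ∈ J \ A ∧ ∀ a ∈ A, R a (φ x) := fun x hx h0 =>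
      mem_filter.1 (hφ x (mem_filter.2 ⟨hx, h0⟩))
    refine ⟨fun x => if lev x = 0 then ψ x else φ x, ?_, ?_, ?_⟩
    · intro x hx y hy hxy
      simp only at hxy
      split_ifs at hxy with h1 h2 h2
      · exact hψinj (mem_coe.2 (mem_filter.2 ⟨hx, h1⟩)) (mem_coe.2 (mem_filter.2 ⟨hy, h2⟩)) hxy
      · exact absurd (hxy ▸ hψ' x hx h1) (mem_sdiff.1 (hφ' y hy h2).1).2
      · exact absurd (hxy ▸ hψ' y hy h2) (mem_sdiff.1 (hφ' x hx h1).1).2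
      · exact hinj (mem_coe.2 (mem_filter.2 ⟨hx, h1⟩)) (mem_coe.2 (mem_filter.2 ⟨hy, h2⟩)) hxy
    · intro x hx
      simp only
      split_ifs with h1
      · exact hAJ (hψ' x hx h1)
      · exact (mem_sdiff.1 (hφ' x hx h1).1).1
    · intro x hx y hy hxy
      rcases hxy.eq_or_lt with rfl | hlt
      · exact hR _
      · have h2 : lev y ≠ 0 := by
          have := hlev x hx y hy hlt
          omega
        simp only [if_neg h2]
        split_ifs with h1
        · exact (hφ' y hy h2).2 _ (hψ' x hx h1)
        · exact hφR x (mem_filter.2 ⟨hx, h1⟩) y (mem_filter.2 ⟨hy, h2⟩) hxy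

/-- A finite poset has a strictly monotone level function with values below its height. -/
theorem exists_level_lt_posetHeight (P : Type*) [PartialOrder P] [Finite P] :
    ∃ lev : P → ℕ, (∀ x y, x < y → lev x < lev y) ∧ ∀ x, lev x < posetHeight P := by
  have hchain : ∀ p : LTSeries P, p.length + 1 ≤ posetHeight P := by
    intro p
    have hc : IsChain (· ≤ ·) (Set.range p) := p.strictMono.monotone.isChain_range
    have h1 := Set.encard_le_chainHeight_of_isChain Set.univ _ (Set.subset_univ _) hc
    have h2 : (Set.range p).encard = (p.length + 1 : ℕ) := by
      rw [← Set.image_univ, p.strictMono.injective.injOn.encard_image]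
      simp
    rw [h2] at h1
    have htop : (Set.univ : Set P).chainHeight (· ≤ ·) ≠ ⊤ :=
      Set.chainHeight_ne_top_of_finite _ _ Set.finite_univ
    rw [posetHeight]
    rwa [← ENat.natCast_toNat htop, Nat.cast_le] at h1
  have hle : ∀ x : P, Order.height x ≤ (posetHeight P - 1 : ℕ) := fun x =>
    Order.height_le fun p _ => by
      have := hchain p
      exact_mod_cast (by omega : p.length ≤ posetHeight P - 1)
  have hfin : ∀ x : P, Order.height x ≠ ⊤ := fun x hx => by
    have := hle x
    rw [hx] at this
    simp at this
  refine ⟨fun x => (Order.height x).toNat, fun x y hxy => ?_, fun x => ?_⟩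
  · have := Order.height_strictMono hxy (lt_top_iff_ne_top.2 (hfin x))
    rw [← ENat.natCast_toNat (hfin x), ← ENat.natCast_toNat (hfin y)] at this
    exact_mod_cast this
  · have h1 := hle x
    rw [← ENat.natCast_toNat (hfin x), Nat.cast_le] at h1
    have h2 := hchain (RelSeries.singleton _ x)
    simp only
    omega

/-! ### Interval chains -/

/-- The subsets of `ℕ` making up an interval chain: an initial interval of length `c.1` together
with the shift of `c.2` by `c.1 + 1`. -/
def intervalChainSet (c : ℕ × Finset ℕ) : Finset ℕ :=
  range c.1 ∪ c.2.map (addRightEmbedding (c.1 + 1))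

theorem mem_intervalChainSet {c : ℕ × Finset ℕ} {x : ℕ} :
    x ∈ intervalChainSet c ↔ x < c.1 ∨ ∃ u ∈ c.2, u + (c.1 + 1) = x := by
  simp [intervalChainSet]

theorem card_intervalChainSet (c : ℕ × Finset ℕ) : #(intervalChainSet c) = c.1 + #c.2 := by
  rw [intervalChainSet, card_union_of_disjoint, card_range, card_map]
  rw [disjoint_left]
  intro x hx hx'
  rw [mem_range] at hx
  simp only [mem_map, addRightEmbedding_apply] at hx'
  obtain ⟨u, -, hu⟩ := hx'
  omega

/-- The first coordinate is the least number missing from the set, and it determines the shift. -/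
theorem intervalChainSet_injective : Function.Injective intervalChainSet := by
  have key : ∀ c d : ℕ × Finset ℕ, intervalChainSet c = intervalChainSet d → d.1 ≤ c.1 := by
    intro c d h
    by_contra! hlt
    have h1 : c.1 ∈ intervalChainSet d := mem_intervalChainSet.2 (.inl hlt)
    rw [← h, mem_intervalChainSet] at h1
    rcases h1 with h1 | ⟨u, -, hu⟩ <;> omega
  rintro ⟨i, U⟩ ⟨j, W⟩ h
  obtain rfl : i = j := le_antisymm (key _ _ h.symm) (key _ _ h)
  have sub : ∀ U W : Finset ℕ, intervalChainSet (i, U) = intervalChainSet (i, W) → U ⊆ W := by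
    intro U W h u hu
    have h1 : u + (i + 1) ∈ intervalChainSet (i, U) := mem_intervalChainSet.2 (.inr ⟨u, hu, rfl⟩)
    rw [h, mem_intervalChainSet] at h1
    rcases h1 with h1 | ⟨w, hw, hwu⟩
    · simp only at h1
      omega
    · simp only at hwu hw
      rwa [show u = w by omega]
  rw [Subset.antisymm (sub U W h) (sub W U h.symm)]

theorem intervalChainSet_subset_range {l : ℕ} {c : ℕ × Finset ℕ} (hc : c.2 ⊆ range l) :
    intervalChainSet c ⊆ range (c.1 + (l + 1)) := by
  intro x hx
  rw [mem_range]
  rcases mem_intervalChainSet.1 hx with h | ⟨u, hu, rfl⟩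
  · omega
  · have := mem_range.1 (hc hu)
    omega

/-- The sets of an interval chain are ordered by size; among those of a given size, the one reaching
furthest comes last. -/
def intervalChainKey (l : ℕ) (c : ℕ × Finset ℕ) : ℕ :=
  2 * (c.1 + #c.2) + if c.2 = {l} then 1 else 0

/-- At a fixed size, a larger `U` means a shorter initial interval, so only the singleton `{l}`
reaches one place further. This is why the key singles it out. -/
theorem intervalChainSet_subset_range_of_ne {l : ℕ} {c : ℕ × Finset ℕ} (hc : c.2 ⊆ range (l + 1))
    (hne : c.2 ≠ {l}) : intervalChainSet c ⊆ range (c.1 + #c.2 + l) := by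
  intro x hx
  rw [mem_range]
  rcases mem_intervalChainSet.1 hx with h | ⟨u, hu, rfl⟩
  · omega
  · have h1 := mem_range.1 (hc hu)
    have h2 : 0 < #c.2 := card_pos.2 ⟨u, hu⟩
    by_cases h3 : #c.2 = 1
    · obtain ⟨w, hw⟩ := card_eq_one.1 h3
      rw [hw, mem_singleton] at hu
      have : w ≠ l := fun h => hne (by rw [hw, h])
      omega
    · omega

theorem sum_card_powerset_range (l : ℕ) :
    ∑ U ∈ (range (l + 1)).powerset, (l + #U) = (3 * l + 1) * 2 ^ l := by
  rw [sum_add_distrib, sum_const, card_powerset, card_range,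
    sum_powerset_apply_card (fun m => m), card_range]
  have := Nat.sum_range_mul_choose (l + 1)
  simp only [smul_eq_mul, mul_comm (Nat.choose _ _)] at this ⊢
  rw [this, Nat.add_sub_cancel]
  ring

/-- The number of sets in an interval chain of size at least `t` not containing `range (t + l)`. -/
theorem card_le_of_size_ge {l : ℕ} (t : ℕ) (T : Finset (ℕ × Finset ℕ))
    (hT : ∀ c ∈ T, c.2 ⊆ range (l + 1) ∧ t ≤ c.1 + #c.2 ∧
      ¬ range (t + l) ⊆ intervalChainSet c) : #T ≤ (3 * l + 1) * 2 ^ l := by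
  classical
  -- For fixed `U`, the first coordinate is at least `t - #U` by size and below `t + l` by
  -- non-containment: at most `l + #U` values.
  calc #T ≤ #((range (l + 1)).powerset.sigma fun U => Ico (t - #U) (t + l)) := by
        refine card_le_card_of_injOn (fun c => ⟨c.2, c.1⟩) (fun c hc => ?_) ?_
        · obtain ⟨h1, h2, h3⟩ := hT c hc
          simp only [coe_sigma, Set.mem_sigma_iff, mem_coe, mem_powerset, mem_Ico]
          refine ⟨h1, by omega, ?_⟩
          by_contra! h4
          exact h3 fun x hx => mem_intervalChainSet.2 (.inl ((mem_range.1 hx).trans_le h4))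
        · rintro ⟨i, U⟩ - ⟨j, W⟩ - h
          simp only [Sigma.mk.injEq, heq_eq_eq] at h
          rw [h.1, h.2]
    _ = ∑ U ∈ (range (l + 1)).powerset, (t + l - (t - #U)) := by simp [card_sigma]
    _ ≤ ∑ U ∈ (range (l + 1)).powerset, (l + #U) := sum_le_sum fun U _ => by omega
    _ = _ := sum_card_powerset_range l

/-- All sets up to `X` lie in `range (t + l)` and all sets after `X` have size at least `t`, where
`t` is the size of `X`, raised by one if `X` is the last set of its size. A bad `Y` therefore fails
to contain `range (t + l)`. -/
theorem card_bad_le {l : ℕ} {C : Finset (ℕ × Finset ℕ)} (hC : ∀ c ∈ C, c.2 ⊆ range (l + 1))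
    (X : ℕ × Finset ℕ) (T : Finset (ℕ × Finset ℕ)) (hTC : T ⊆ C)
    (hT : ∀ Y ∈ T, Y ≠ X ∧ intervalChainKey l X ≤ intervalChainKey l Y ∧
      ∃ Z ∈ C, intervalChainKey l Z ≤ intervalChainKey l X ∧
        ¬ intervalChainSet Z ⊆ intervalChainSet Y) :
    #T ≤ (3 * l + 1) * 2 ^ l := by
  refine card_le_of_size_ge (X.1 + #X.2 + if X.2 = {l} then 1 else 0) T fun Y hY => ?_
  obtain ⟨hYX, hXY, Z, hZ, hZX, hZY⟩ := hT Y hY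
  refine ⟨hC Y (hTC hY), ?_, fun hsub => hZY (Subset.trans ?_ hsub)⟩
  · unfold intervalChainKey at hXY
    by_cases hX : X.2 = {l}
    · by_cases hY' : Y.2 = {l}
      · have : Y.1 ≠ X.1 := fun h => hYX (Prod.ext h (hY'.trans hX.symm))
        simp only [hX, hY', if_true, card_singleton] at hXY ⊢
        omega
      · simp only [hX, hY', if_true, if_false] at hXY ⊢
        omega
    · simp only [hX, if_false] at hXY ⊢
      split_ifs at hXY <;> omega
  · unfold intervalChainKey at hZX
    by_cases hZ' : Z.2 = {l}
    · refine (intervalChainSet_subset_range (hC Z hZ)).trans (range_subset_range.2 ?_)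
      simp only [hZ', if_true, card_singleton] at hZX
      split_ifs at hZX ⊢ <;> omega
    · refine (intervalChainSet_subset_range_of_ne (hC Z hZ) hZ').trans (range_subset_range.2 ?_)
      simp only [hZ', if_false] at hZX
      split_ifs at hZX ⊢ <;> omega

/-- The sets of the interval chain contained in `range n`. -/
def intervalChain (l n : ℕ) : Finset (ℕ × Finset ℕ) :=
  (range (n + 1) ×ˢ (range (l + 1)).powerset).filter fun c => intervalChainSet c ⊆ range n

theorem mem_intervalChain {l n : ℕ} {c : ℕ × Finset ℕ} :
    c ∈ intervalChain l n ↔ c.2 ⊆ range (l + 1) ∧ intervalChainSet c ⊆ range n := by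
  simp only [intervalChain, mem_filter, mem_product, mem_range, mem_powerset]
  refine ⟨fun h => ⟨h.1.2, h.2⟩, fun h => ⟨⟨?_, h.1⟩, h.2⟩⟩
  have := card_le_card h.2
  rw [card_intervalChainSet, card_range] at this
  omega

/-- A large part of an interval chain contains every small poset. -/
theorem exists_embedding_intervalChain (P : Type*) [PartialOrder P] [Finite P] {l n : ℕ}
    {J : Finset (ℕ × Finset ℕ)} (hJ : J ⊆ intervalChain l n)
    (hcard : Nat.card P + (posetHeight P - 1) * ((3 * l + 1) * 2 ^ l) ≤ #J) :
    ∃ φ : P → ℕ × Finset ℕ, Function.Injective φ ∧ (∀ x, φ x ∈ J) ∧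
      ∀ x y, x ≤ y → intervalChainSet (φ x) ⊆ intervalChainSet (φ y) := by
  have := Fintype.ofFinite P
  obtain ⟨lev, hlev, hlt⟩ := exists_level_lt_posetHeight P
  obtain ⟨φ, h1, h2, h3⟩ := exists_embedding_of_key
    (fun c d => intervalChainSet c ⊆ intervalChainSet d) (fun _ => Subset.rfl)
    (intervalChainKey l) (intervalChain l n) _
    (fun X _ T hT => card_bad_le (fun c hc => (mem_intervalChain.1 hc).1) X T hT)
    (posetHeight P - 1) J (univ : Finset P) lev hJ (fun x _ y _ => hlev x y)
    (fun x _ => Nat.le_sub_one_of_lt (hlt x))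
    (by rwa [card_univ, ← Nat.card_eq_fintype_card])
  exact ⟨φ, fun x y hxy => h1 (by simp) (by simp) hxy, fun x => h2 x (mem_univ x),
    fun x y => h3 x (mem_univ x) y (mem_univ y)⟩

theorem card_intervalChain_size_pos {l n m : ℕ} (hm : m ≤ n) :
    1 ≤ #((intervalChain l n).filter fun c => c.1 + #c.2 = m) := by
  refine card_pos.2 ⟨(m, ∅), mem_filter.2 ⟨mem_intervalChain.2 ⟨by simp, ?_⟩, by simp⟩⟩
  simpa [intervalChainSet] using hm

theorem two_pow_le_card_intervalChain_size {l n m : ℕ} (hlm : l + 1 ≤ m) (hm : m + l + 2 ≤ n) :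
    2 ^ (l + 1) ≤ #((intervalChain l n).filter fun c => c.1 + #c.2 = m) := by
  have hcard : #(range (l + 1)).powerset = 2 ^ (l + 1) := by rw [card_powerset, card_range]
  rw [← hcard]
  -- The subtraction does not truncate, since `#U ≤ l + 1 ≤ m`.
  refine card_le_card_of_injOn (fun U => (m - #U, U)) (fun U hU => ?_) fun U _ W _ h =>
    congrArg Prod.snd h
  have hU' := mem_powerset.1 (mem_coe.1 hU)
  have hUcard := card_le_card hU'
  rw [card_range] at hUcard
  refine mem_coe.2 (mem_filter.2 ⟨mem_intervalChain.2 ⟨hU', ?_⟩, by simp only; omega⟩)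
  exact (intervalChainSet_subset_range hU').trans (range_subset_range.2 (by simp only; omega))

/-! ### Growth of Gaussian binomials -/

/-- The `q`-factorial, up to a power of `q - 1`. -/
def qFactorial (q : ℝ) (n : ℕ) : ℝ := ∏ i ∈ range n, (q ^ (i + 1) - 1)

theorem qFactorial_succ (q : ℝ) (n : ℕ) :
    qFactorial q (n + 1) = qFactorial q n * (q ^ (n + 1) - 1) := prod_range_succ _ _

theorem pow_succ_sub_one_pos {q : ℝ} (hq : 1 < q) (n : ℕ) : 0 < q ^ (n + 1) - 1 :=
  sub_pos.2 (one_lt_pow₀ hq n.succ_ne_zero)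

theorem qFactorial_pos {q : ℝ} (hq : 1 < q) (n : ℕ) : 0 < qFactorial q n :=
  prod_pos fun i _ => pow_succ_sub_one_pos hq i

theorem qFactorial_eq_prod_reflect (q : ℝ) (m : ℕ) :
    qFactorial q m = ∏ i ∈ range m, (q ^ (m - i) - 1) := by
  rw [qFactorial, ← prod_range_reflect]
  refine prod_congr rfl fun i hi => ?_
  have := mem_range.1 hi
  rw [show m - 1 - i + 1 = m - i by omega]

theorem prod_mul_qFactorial (q : ℝ) {n m : ℕ} (hm : m ≤ n) :
    (∏ i ∈ range m, (q ^ (n - i) - 1)) * qFactorial q (n - m) = qFactorial q n := by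
  induction m with
  | zero => simp
  | succ m ih =>
    rw [← ih (by omega), prod_range_succ, show n - m = n - (m + 1) + 1 by omega,
      qFactorial_succ]
    ring

theorem gaussBinom_mul_qFactorial {q : ℕ} (hq : 1 < q) {n m : ℕ} (hm : m ≤ n) :
    gaussBinom q n m * (qFactorial q m * qFactorial q (n - m)) = qFactorial q n := by
  have hq' : (1 : ℝ) < q := by exact_mod_cast hq
  have h0 := (qFactorial_pos hq' m).ne'
  rw [gaussBinom, prod_div_distrib, ← qFactorial_eq_prod_reflect, ← mul_assoc,
    div_mul_cancel₀ _ h0, prod_mul_qFactorial _ hm]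

theorem gaussBinom_eq_div {q : ℕ} (hq : 1 < q) {n m : ℕ} (hm : m ≤ n) :
    gaussBinom q n m = qFactorial q n / (qFactorial q m * qFactorial q (n - m)) := by
  have hq' : (1 : ℝ) < q := by exact_mod_cast hq
  exact eq_div_of_mul_eq (mul_pos (qFactorial_pos hq' _) (qFactorial_pos hq' _)).ne'
    (gaussBinom_mul_qFactorial hq hm)

theorem gaussBinom_pos {q : ℕ} (hq : 1 < q) {n m : ℕ} (hm : m ≤ n) : 0 < gaussBinom q n m := by
  have hq' : (1 : ℝ) < q := by exact_mod_cast hq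
  rw [gaussBinom_eq_div hq hm]
  exact div_pos (qFactorial_pos hq' _) (mul_pos (qFactorial_pos hq' _) (qFactorial_pos hq' _))

theorem gaussBinom_symm {q : ℕ} (hq : 1 < q) {n m : ℕ} (hm : m ≤ n) :
    gaussBinom q n (n - m) = gaussBinom q n m := by
  rw [gaussBinom_eq_div hq hm, gaussBinom_eq_div hq (n.sub_le m), Nat.sub_sub_self hm, mul_comm]

/-- The ratio of the two coefficients is `(q^(n-m) - 1) / (q^(m+1) - 1)`, with `n - m ≥ m + 2` and
`q ≥ 2`. The bound is uniform in `q`. -/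
theorem two_mul_gaussBinom_le {q : ℕ} (hq : 1 < q) {n m : ℕ} (hm : 2 * (m + 1) ≤ n) :
    2 * gaussBinom q n m ≤ gaussBinom q n (m + 1) := by
  have hq' : (1 : ℝ) < q := by exact_mod_cast hq
  have hq2 : (2 : ℝ) ≤ q := by exact_mod_cast hq
  have hpos := gaussBinom_pos hq (show m ≤ n by omega)
  have e1 := gaussBinom_mul_qFactorial hq (show m ≤ n by omega)
  have e2 := gaussBinom_mul_qFactorial hq (show m + 1 ≤ n by omega)
  rw [← e2, show n - m = n - (m + 1) + 1 by omega, qFactorial_succ, qFactorial_succ] at e1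
  have hA := qFactorial_pos hq' m
  have hB := qFactorial_pos hq' (n - (m + 1))
  have e3 : gaussBinom q n m * ((q : ℝ) ^ (n - (m + 1) + 1) - 1) =
      gaussBinom q n (m + 1) * ((q : ℝ) ^ (m + 1) - 1) := by
    apply mul_right_cancel₀ (mul_pos hA hB).ne'
    linear_combination e1
  have hc := pow_succ_sub_one_pos hq' m
  refine le_of_mul_le_mul_right ?_ hc
  rw [← e3, mul_comm 2, mul_assoc]
  refine mul_le_mul_of_nonneg_left ?_ hpos.le
  have h1 : (q : ℝ) ^ (m + 2) ≤ (q : ℝ) ^ (n - (m + 1) + 1) :=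
    pow_le_pow_right₀ hq'.le (by omega)
  have h2 : 2 * (q : ℝ) ^ (m + 1) ≤ (q : ℝ) ^ (m + 2) := by
    rw [pow_succ _ (m + 1), mul_comm]
    exact mul_le_mul_of_nonneg_left hq2 (by positivity)
  linarith

theorem two_pow_mul_gaussBinom_le {q : ℕ} (hq : 1 < q) {n m : ℕ} (j : ℕ) (hm : 2 * (m + j) ≤ n) :
    2 ^ j * gaussBinom q n m ≤ gaussBinom q n (m + j) := by
  induction j with
  | zero => simp
  | succ j ih =>
    have h1 := ih (by omega)
    have h2 := two_mul_gaussBinom_le hq (n := n) (m := m + j) (by omega)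
    rw [pow_succ, ← add_assoc]
    linarith

theorem two_pow_mul_gaussBinom_le_central {q : ℕ} (hq : 1 < q) {n m j : ℕ} (hm : m ≤ n)
    (hj : j + min m (n - m) ≤ n / 2) :
    2 ^ j * gaussBinom q n m ≤ gaussBinom q n (n / 2) := by
  have main : ∀ m, j + m ≤ n / 2 → 2 ^ j * gaussBinom q n m ≤ gaussBinom q n (n / 2) := by
    intro m hm
    have h := two_pow_mul_gaussBinom_le hq (n := n) (m := m) (n / 2 - m) (by omega)
    rw [show m + (n / 2 - m) = n / 2 by omega] at h
    refine le_trans (mul_le_mul_of_nonneg_right ?_ (gaussBinom_pos hq (by omega)).le) h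
    exact pow_le_pow_right₀ one_le_two (by omega)
  rcases le_total m (n - m) with h | h
  · exact main m (by omega)
  · rw [← gaussBinom_symm hq hm]
    exact main (n - m) (by omega)

/-! ### Counting subspaces and the action of `GL(V)` -/

section Subspaces

variable {K V : Type*} [Field K] [AddCommGroup V] [Module K V]

theorem LinearIndependent.span_range_coe_eq {U : Submodule K V} [FiniteDimensional K U]
    {s : Fin (Module.finrank K U) → U} (hs : LinearIndependent K s) :
    Submodule.span K (Set.range fun i => (s i : V)) = U := by
  have h := hs.span_eq_top_of_card_eq_finrank' (by simp)
  have h2 := congrArg (Submodule.map U.subtype) h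
  rw [Submodule.map_span, Submodule.map_top, Submodule.range_subtype, ← Set.range_comp] at h2
  exact h2

/-- Linearly independent families, sorted by their span. -/
theorem card_linearIndependent_eq_mul [Finite K] [FiniteDimensional K V] (m : ℕ) :
    Nat.card {s : Fin m → V // LinearIndependent K s} =
      Nat.card {U : Submodule K V // Module.finrank K U = m} *
        ∏ i : Fin m, (Nat.card K ^ m - Nat.card K ^ i.val) := by
  classical
  have := Fintype.ofFinite K
  have : Finite V := Module.finite_of_finite K
  have := Fintype.ofFinite (Submodule K V)
  let f : (Σ U : {U : Submodule K V // Module.finrank K U = m},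
      {s : Fin m → U.1 // LinearIndependent K s}) → {s : Fin m → V // LinearIndependent K s} :=
    fun x => ⟨fun i => x.2.1 i, x.2.2.map' x.1.1.subtype (Submodule.ker_subtype _)⟩
  have hspan : ∀ x, Submodule.span K (Set.range (f x).1) = x.1.1 := by
    rintro ⟨⟨U, rfl⟩, s, hs⟩
    exact hs.span_range_coe_eq
  have hf : Function.Bijective f := by
    constructor
    · intro x y hxy
      have hU : x.1 = y.1 := Subtype.ext (by rw [← hspan x, ← hspan y, hxy])
      obtain ⟨U, s⟩ := x
      obtain ⟨U', s'⟩ := y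
      obtain rfl : U = U' := hU
      have : s = s' := Subtype.ext (funext fun i =>
        Subtype.ext (congrFun (congrArg Subtype.val hxy) i))
      rw [this]
    · rintro ⟨s, hs⟩
      exact ⟨⟨⟨Submodule.span K (Set.range s), by rw [finrank_span_eq_card hs, Fintype.card_fin]⟩,
        fun i => ⟨s i, Submodule.subset_span ⟨i, rfl⟩⟩, linearIndependent_span hs⟩, rfl⟩
  rw [← Nat.card_congr (Equiv.ofBijective f hf), Nat.card_sigma]
  have : ∀ U : {U : Submodule K V // Module.finrank K U = m},
      Nat.card {s : Fin m → U.1 // LinearIndependent K s} =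
        ∏ i : Fin m, (Nat.card K ^ m - Nat.card K ^ i.val) := by
    rintro ⟨U, rfl⟩
    rw [card_linearIndependent le_rfl, Nat.card_eq_fintype_card]
  simp [this, Nat.card_eq_fintype_card]

theorem prod_pow_sub_pow {q n m : ℕ} (hq : 1 < q) (hm : m ≤ n) :
    ((∏ i : Fin m, (q ^ n - q ^ i.val) : ℕ) : ℝ) =
      (∏ i ∈ range m, (q : ℝ) ^ i) * ∏ i ∈ range m, ((q : ℝ) ^ (n - i) - 1) := by
  rw [Fin.prod_univ_eq_prod_range (fun i => q ^ n - q ^ i), ← prod_mul_distrib, Nat.cast_prod]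
  refine prod_congr rfl fun i hi => ?_
  have hi := mem_range.1 hi
  rw [Nat.cast_sub (Nat.pow_le_pow_right hq.le (by omega)), mul_sub, ← pow_add,
    show i + (n - i) = n by omega]
  push_cast
  ring

/-- The number of `m`-dimensional subspaces is the Gaussian binomial coefficient. -/
theorem card_submodule_finrank_eq [Finite K] [FiniteDimensional K V] {m : ℕ}
    (hm : m ≤ Module.finrank K V) :
    (Nat.card {U : Submodule K V // Module.finrank K U = m} : ℝ) =
      gaussBinom (Nat.card K) (Module.finrank K V) m := by
  have hft := Fintype.ofFinite K
  have : Finite V := Module.finite_of_finite K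
  have hq : 1 < Nat.card K := Finite.one_lt_card
  have hq' : (1 : ℝ) < Nat.card K := by exact_mod_cast hq
  have h := card_linearIndependent_eq_mul (K := K) (V := V) m
  rw [card_linearIndependent hm, ← Nat.card_eq_fintype_card] at h
  have h' := congrArg (Nat.cast : ℕ → ℝ) h
  rw [Nat.cast_mul, prod_pow_sub_pow hq hm, prod_pow_sub_pow hq le_rfl,
    ← qFactorial_eq_prod_reflect] at h'
  have h1 : (∏ i ∈ range m, (Nat.card K : ℝ) ^ i) ≠ 0 :=
    prod_ne_zero_iff.2 fun i _ => (pow_pos (zero_lt_one.trans hq') i).ne'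
  rw [gaussBinom, prod_div_distrib, ← qFactorial_eq_prod_reflect]
  refine eq_div_of_mul_eq (qFactorial_pos hq' m).ne' (mul_left_cancel₀ h1 ?_)
  linear_combination -h'

/-- The images of a subspace under the general linear group are equidistributed. -/
theorem card_map_eq_mul [Finite K] [FiniteDimensional K V] (W U : Submodule K V)
    (h : Module.finrank K U = Module.finrank K W) :
    Nat.card {g : V ≃ₗ[K] V // W.map (g : V →ₗ[K] V) = U} *
      Nat.card {U : Submodule K V // Module.finrank K U = Module.finrank K W} =
      Nat.card (V ≃ₗ[K] V) := by
  classical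
  have : Finite V := Module.finite_of_finite K
  have : Finite (V ≃ₗ[K] V) := Finite.of_injective _ DFunLike.coe_injective
  have := Fintype.ofFinite (Submodule K V)
  let f : (V ≃ₗ[K] V) → {U : Submodule K V // Module.finrank K U = Module.finrank K W} :=
    fun g => ⟨W.map (g : V →ₗ[K] V), LinearEquiv.finrank_map_eq g W⟩
  rw [← Nat.card_congr (Equiv.sigmaFiberEquiv f), Nat.card_sigma]
  have key : ∀ U', Nat.card {g // f g = U'} =
      Nat.card {g : V ≃ₗ[K] V // W.map (g : V →ₗ[K] V) = U} := by
    rintro ⟨U', hU'⟩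
    -- An isomorphism `U' ≃ U` extends to an automorphism `t` of `V`; left multiplication by `t`
    -- matches the two fibres.
    obtain ⟨t, ht⟩ := Submodule.exists_linearEquiv_restrict_eq
      (LinearEquiv.ofFinrankEq U' U (hU'.trans h.symm))
    have htU : U'.map (t : V →ₗ[K] V) = U := by
      refine Submodule.eq_of_le_of_finrank_eq ?_ ?_
      · rintro _ ⟨x, hx, rfl⟩
        have := ht ⟨x, hx⟩
        rw [LinearEquiv.coe_coe, ← this]
        exact Subtype.coe_prop _
      · rw [LinearEquiv.finrank_map_eq, hU', h]
    refine Nat.card_congr ((Equiv.mulLeft (t : V ≃ₗ[K] V)).subtypeEquiv fun g => ?_)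
    rw [Subtype.ext_iff]
    have : W.map ((Equiv.mulLeft t g : V ≃ₗ[K] V) : V →ₗ[K] V) =
        (W.map (g : V →ₗ[K] V)).map (t : V →ₗ[K] V) := by
      rw [← Submodule.map_comp]
      rfl
    rw [this, ← htU]
    exact (Submodule.map_injective_of_injective (f := (t : V →ₗ[K] V)) t.injective).eq_iff.symm
  simp [key, Nat.card_eq_fintype_card, mul_comm]

end Subspaces

/-! ### Averaging over images of the interval chain -/

section Averaging

variable {K V : Type*} [Field K] [AddCommGroup V] [Module K V]

/-- The subspace spanned by the basis vectors with indices in `S`. -/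
def basisSpan {n : ℕ} (b : Module.Basis (Fin n) K V) (S : Finset ℕ) : Submodule K V :=
  Submodule.span K (b '' {i | (i : ℕ) ∈ S})

theorem basisSpan_mono {n : ℕ} (b : Module.Basis (Fin n) K V) {S T : Finset ℕ} (h : S ⊆ T) :
    basisSpan b S ≤ basisSpan b T :=
  Submodule.span_mono (Set.image_mono fun _ hi => h hi)

theorem subset_of_basisSpan_le {n : ℕ} (b : Module.Basis (Fin n) K V) {S T : Finset ℕ}
    (hS : S ⊆ range n) (h : basisSpan b S ≤ basisSpan b T) : S ⊆ T := by
  intro x hx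
  have hxn := mem_range.1 (hS hx)
  have h1 : b ⟨x, hxn⟩ ∈ basisSpan b T := h (Submodule.subset_span ⟨⟨x, hxn⟩, hx, rfl⟩)
  exact b.self_mem_span_image.1 h1

theorem finrank_basisSpan {n : ℕ} (b : Module.Basis (Fin n) K V) {S : Finset ℕ}
    (hS : S ⊆ range n) : Module.finrank K (basisSpan b S) = #S := by
  classical
  have h : (b '' {i | (i : ℕ) ∈ S}) =
      Set.range fun i : {i : Fin n // (i : ℕ) ∈ S} => b i := by
    rw [Set.image_eq_range]
    rfl
  rw [basisSpan, h]
  refine (finrank_span_eq_card (b.linearIndependent.comp _ Subtype.val_injective)).trans ?_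
  rw [Fintype.card_subtype]
  refine card_bij (fun i _ => (i : ℕ)) (by simp) (fun i _ j _ h => Fin.ext h) fun x hx => ?_
  exact ⟨⟨x, mem_range.1 (hS hx)⟩, by simpa using hx, rfl⟩

theorem card_intervalChain_map_le {P : Type*} [PartialOrder P] [Finite P]
    {𝓕 : Set (Submodule K V)} (hP : ¬ IsSubposet P 𝓕) {n : ℕ} (b : Module.Basis (Fin n) K V)
    (l : ℕ) (g : V ≃ₗ[K] V) {J : Finset (ℕ × Finset ℕ)} (hJ : J ⊆ intervalChain l n)
    (hJF : ∀ c ∈ J, (basisSpan b (intervalChainSet c)).map (g : V →ₗ[K] V) ∈ 𝓕) :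
    #J + 1 ≤ Nat.card P + (posetHeight P - 1) * ((3 * l + 1) * 2 ^ l) := by
  by_contra! hlt
  obtain ⟨φ, hinj, hφ, hmono⟩ := exists_embedding_intervalChain P hJ (by omega)
  have hsub : ∀ x, intervalChainSet (φ x) ⊆ range n := fun x =>
    (mem_intervalChain.1 (hJ (hφ x))).2
  refine hP ⟨fun x => ⟨_, hJF (φ x) (hφ x)⟩, fun x y hxy => hinj ?_, fun x y hxy => ?_⟩
  · have h : basisSpan b (intervalChainSet (φ x)) = basisSpan b (intervalChainSet (φ y)) :=
      Submodule.map_injective_of_injective (f := (g : V →ₗ[K] V)) g.injective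
        (congrArg Subtype.val hxy)
    exact intervalChainSet_injective (Subset.antisymm
      (subset_of_basisSpan_le b (hsub x) h.le) (subset_of_basisSpan_le b (hsub y) h.ge))
  · exact Submodule.map_mono (basisSpan_mono b (hmono x y hxy))

/-- A Lubell-type inequality, from averaging over all images of an interval chain. -/
theorem sum_card_div_gaussBinom_le [Finite K] [FiniteDimensional K V] {P : Type*} [PartialOrder P]
    [Finite P] (𝓕 : Finset (Submodule K V)) (hP : ¬ IsSubposet P (𝓕 : Set (Submodule K V)))
    (l : ℕ) :
    ∑ U ∈ 𝓕, (#((intervalChain l (Module.finrank K V)).filter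
        fun c => c.1 + #c.2 = Module.finrank K U) : ℝ) /
        gaussBinom (Nat.card K) (Module.finrank K V) (Module.finrank K U) + 1 ≤
      Nat.card P + ((posetHeight P - 1 : ℕ) : ℝ) * ((3 * l + 1) * 2 ^ l) := by
  classical
  have : Finite V := Module.finite_of_finite K
  have : Finite (V ≃ₗ[K] V) := Finite.of_injective _ DFunLike.coe_injective
  have := Fintype.ofFinite (V ≃ₗ[K] V)
  have hq : 1 < Nat.card K := Finite.one_lt_card
  set n := Module.finrank K V with hn
  set C := intervalChain l n with hC
  let b : Module.Basis (Fin n) K V := Module.finBasis K V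
  let W : ℕ × Finset ℕ → (V ≃ₗ[K] V) → Submodule K V := fun c g =>
    (basisSpan b (intervalChainSet c)).map (g : V →ₗ[K] V)
  have hWrank : ∀ c ∈ C, Module.finrank K (basisSpan b (intervalChainSet c)) = c.1 + #c.2 := by
    intro c hc
    rw [finrank_basisSpan b (mem_intervalChain.1 hc).2, card_intervalChainSet]
  have hN : ∀ U : Submodule K V, 0 < gaussBinom (Nat.card K) n (Module.finrank K U) := fun U =>
    gaussBinom_pos hq (Submodule.finrank_le U)
  -- By equidistribution, each chain member of the right size hits `U` for a fraction `1 /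
  -- gaussBinom` of all `g`.
  have hcount : ∀ c ∈ C, ∀ U : Submodule K V, (#(univ.filter fun g => W c g = U) : ℝ) =
      if c.1 + #c.2 = Module.finrank K U then
        (Fintype.card (V ≃ₗ[K] V) : ℝ) / gaussBinom (Nat.card K) n (Module.finrank K U)
      else 0 := by
    intro c hc U
    split_ifs with h
    · have hU : Module.finrank K U = Module.finrank K (basisSpan b (intervalChainSet c)) := by
        rw [hWrank c hc, h]
      have h1 := card_map_eq_mul _ U hU
      rw [← hU, Nat.card_eq_fintype_card (α := V ≃ₗ[K] V), Nat.subtype_card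
        (univ.filter fun g => W c g = U) (by simp [W])] at h1
      refine eq_div_of_mul_eq (hN U).ne' ?_
      rw [← card_submodule_finrank_eq (Submodule.finrank_le U)]
      exact_mod_cast h1
    · rw [Nat.cast_eq_zero, card_eq_zero, filter_eq_empty_iff]
      rintro g - rfl
      exact h ((LinearEquiv.finrank_map_eq g _).trans (hWrank c hc)).symm
  have hG : (0 : ℝ) < Fintype.card (V ≃ₗ[K] V) := by exact_mod_cast Fintype.card_pos
  -- Double count the triples `(g, c, U)` with `W c g = U ∈ 𝓕`.
  have hswap : (∑ g : V ≃ₗ[K] V, #(C.filter fun c => W c g ∈ 𝓕)) =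
      ∑ U ∈ 𝓕, ∑ c ∈ C, #(univ.filter fun g => W c g = U) := by
    simp only [card_filter]
    rw [sum_comm' (t' := C) (s' := fun _ => univ) (by simp), sum_comm (s := 𝓕)]
    refine sum_congr rfl fun c _ => ?_
    rw [sum_comm]
    refine sum_congr rfl fun g _ => ?_
    simp
  have hle : ∑ g : V ≃ₗ[K] V, (#(C.filter fun c => W c g ∈ 𝓕) + 1) ≤
      ∑ _g : V ≃ₗ[K] V, (Nat.card P + (posetHeight P - 1) * ((3 * l + 1) * 2 ^ l)) :=
    sum_le_sum fun g _ => card_intervalChain_map_le hP b l g (filter_subset _ _)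
      fun c hc => (mem_filter.1 hc).2
  rw [sum_add_distrib, hswap, sum_const, sum_const, card_univ, smul_eq_mul, smul_eq_mul,
    mul_one] at hle
  have hle' : (((∑ U ∈ 𝓕, ∑ c ∈ C, #(univ.filter fun g => W c g = U)) +
      Fintype.card (V ≃ₗ[K] V) : ℕ) : ℝ) ≤ ((Fintype.card (V ≃ₗ[K] V) *
        (Nat.card P + (posetHeight P - 1) * ((3 * l + 1) * 2 ^ l)) : ℕ) : ℝ) := by
    exact_mod_cast hle
  push_cast at hle'
  rw [sum_congr rfl fun U _ => sum_congr rfl fun c hc => hcount c hc U] at hle'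
  refine le_of_mul_le_mul_left (le_trans (le_of_eq ?_) hle') hG
  rw [mul_add, mul_one, mul_sum]
  congr 1
  refine sum_congr rfl fun U _ => ?_
  rw [← sum_filter, sum_const, nsmul_eq_mul]
  ring

/-- In middle dimensions the factor `2 ^ (l + 1)` comes from the numerator. Otherwise `m` is within
`l + 1` of an end, and at least `l + 1` doublings separate it from the centre because `n ≥ 4 (l +
2)`. -/
theorem two_pow_div_le_card_div_gaussBinom {q l n m : ℕ} (hq : 1 < q) (hn : 4 * (l + 2) ≤ n)
    (hm : m ≤ n) :
    2 ^ (l + 1) / gaussBinom q n (n / 2) ≤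
      (#((intervalChain l n).filter fun c => c.1 + #c.2 = m) : ℝ) / gaussBinom q n m := by
  rw [div_le_div_iff₀ (gaussBinom_pos hq (n.div_le_self 2)) (gaussBinom_pos hq hm)]
  by_cases h : l + 1 ≤ m ∧ m + l + 2 ≤ n
  · have h1 := two_pow_mul_gaussBinom_le_central hq (j := 0) hm (by omega)
    rw [pow_zero, one_mul] at h1
    exact mul_le_mul (by exact_mod_cast two_pow_le_card_intervalChain_size h.1 h.2) h1
      (gaussBinom_pos hq hm).le (Nat.cast_nonneg _)
  · have h1 := two_pow_mul_gaussBinom_le_central hq (j := l + 1) hm (by omega)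
    refine h1.trans (le_mul_of_one_le_left (gaussBinom_pos hq (n.div_le_self 2)).le ?_)
    exact_mod_cast card_intervalChain_size_pos hm

end Averaging

theorem mainTheorem8 (P : Type*) [PartialOrder P] [Finite P] [Nonempty P] (k : ℕ) (hk : 2 ≤ k) :
    ∃ n₀ : ℕ, ∀ n : ℕ, n₀ ≤ n →
      ∀ (K V : Type*) [Field K] [Finite K] [AddCommGroup V] [Module K V] [FiniteDimensional K V],
        Module.finrank K V = n →
          (linearLa K V P : ℝ) ≤
            1 / 2 ^ (k - 1) *
              ((Nat.card P : ℝ) + (3 * (k : ℝ) - 5) * 2 ^ (k - 2) * ((posetHeight P : ℝ) - 1) - 1) *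
              gaussBinom (Nat.card K) n (n / 2) := by
  -- With `k = l + 2`, `(3k - 5) 2 ^ (k - 2)` is the loss `(3l + 1) 2 ^ l`.
  obtain ⟨l, rfl⟩ := Nat.exists_eq_add_of_le' hk
  refine ⟨4 * (l + 2), fun n hn K V _ _ _ _ _ hV => ?_⟩
  subst hV
  have : Finite V := Module.finite_of_finite K
  have hq : 1 < Nat.card K := Finite.one_lt_card
  obtain ⟨𝓕, hP, hcard⟩ := (isGreatest_linearLa K V P).1
  have h := sum_card_div_gaussBinom_le 𝓕.toFinite.toFinset (P := P)
    (by rwa [Set.Finite.coe_toFinset]) l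
  have h1 := card_nsmul_le_sum 𝓕.toFinite.toFinset _ _ fun U _ =>
    two_pow_div_le_card_div_gaussBinom (l := l) hq hn (Submodule.finrank_le U)
  rw [← Set.ncard_eq_toFinset_card 𝓕, hcard, nsmul_eq_mul] at h1
  -- Makes the natural subtraction `posetHeight P - 1` agree with the real one.
  have hheight : 1 ≤ posetHeight P := by
    obtain ⟨lev, -, hlev⟩ := exists_level_lt_posetHeight P
    have := hlev (Classical.arbitrary P)
    omega
  rw [Nat.cast_sub hheight] at h
  have hg := gaussBinom_pos hq (Nat.div_le_self (Module.finrank K V) 2)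
  have h2 := h1.trans (le_sub_iff_add_le.2 h)
  rw [← mul_div_assoc, div_le_iff₀ hg] at h2
  have hpow : (0 : ℝ) < 2 ^ (l + 1) := by positivity
  rw [show l + 2 - 1 = l + 1 by omega, Nat.add_sub_cancel, mul_assoc, one_div,
    ← div_eq_inv_mul, le_div_iff₀ hpow]
  refine h2.trans (le_of_eq ?_)
  push_cast
  ring
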